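/- All graphs are finite and simple. An $i$-packing in a graph $H$ is a set of vertices any two distinct members of which are at distance greater than $i$ in $H$. A graph $H$ is $(1,1,2,2)$-colorable if $V(H)$ can be partitioned into four (possibly empty) sets $\Pi_1,\Pi_2,\Pi_3,\Pi_4$ such that $\Pi_1,\Pi_2$ are $1$-packings and $\Pi_3,\Pi_4$ are $2$-packings. The packing chromatic number $\chi_\rho(H)$ is the smallest integer $k$ for which $V(H)$ can be partitioned into (possibly empty) sets $\Pi_1,\dots,\Pi_k$ such that $\Pi_i$ is an $i$-packing for each $i\in\{1,\dots,k\}$. The subdivision $S(H)$ is obtained from $H$ by replacing each edge by a path of length $2$ through a new vertex. **Theorem.** Let $G$ be a connected cubic graph of order $2n$ with a $2$-factor $\mathcal F$ (a spanning $2$-regular subgraph) and a perfect matching $M$. Suppose that $\mathcal F$ contains a cycle $C$ of length $n$ such that no edge of $M$ has both endvertices in $C$, and that $\mathcal F$ contains at most one $5$-cycle ($C$ included in the count). Then $G$ is $(1,1,2,2)$-colorable, and hence $\chi_\rho(S(G))\le 5$. -/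

import Mathlib

namespace PackingColoring

/-- `W` is an `i`-packing of `G`: any two distinct vertices of `W` are at distance greater than `i`
(vertices in different components are at infinite distance). -/
def IsPacking {V : Type*} (G : SimpleGraph V) (i : ℕ) (W : Set V) : Prop :=
  ∀ u ∈ W, ∀ v ∈ W, u ≠ v → (i : ℕ∞) < G.edist u v

/-- `G` is `S`-colorable for the sequence `S = (s 0, …, s (k - 1))`: the vertex set is partitioned
into `k` (possibly empty) classes, the class with index `j` being an `s j`-packing. -/
def IsSColorable {V : Type*} (G : SimpleGraph V) {k : ℕ} (s : Fin k → ℕ) : Prop :=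
  ∃ c : V → Fin k, ∀ j : Fin k, IsPacking G (s j) (c ⁻¹' {j})

/-- `G` is `k`-packing colorable: there is a map from the vertices to the colors `1, …, k`
(color `j + 1` is represented by `j : Fin k`) such that the vertices of color `i` form an
`i`-packing. -/
def IsPackingColorable {V : Type*} (G : SimpleGraph V) (k : ℕ) : Prop :=
  ∃ c : V → Fin k, ∀ j : Fin k, IsPacking G ((j : ℕ) + 1) (c ⁻¹' {j})

/-- The packing chromatic number: the least `k` such that `G` is `k`-packing colorable
(`⊤` if there is no such `k`). -/
noncomputable def packingChromaticNumber {V : Type*} (G : SimpleGraph V) : ℕ∞ :=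
  ⨅ k ∈ {k : ℕ | IsPackingColorable G k}, (k : ℕ∞)

/-- The subdivision `S(G)`: its vertices are the vertices and the edges of `G`, and the new vertex
of an edge `e` is joined to the two endpoints of `e`. -/
def subdivision {V : Type*} (G : SimpleGraph V) : SimpleGraph (V ⊕ G.edgeSet) where
  Adj
    | Sum.inl v, Sum.inr e => v ∈ (e : Sym2 V)
    | Sum.inr e, Sum.inl v => v ∈ (e : Sym2 V)
    | _, _ => False
  symm := ⟨by rintro (u | e) (v | f) h <;> exact h⟩
  loopless := ⟨by rintro (u | e) h <;> exact h⟩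

/-- `F` is a 2-factor of `G`: a spanning subgraph in which every vertex has exactly two
neighbors. -/
def IsTwoFactor {V : Type*} {G : SimpleGraph V} (F : G.Subgraph) : Prop :=
  F.IsSpanning ∧ ∀ v : V, (F.neighborSet v).ncard = 2

/-- The subgraph `C` is a cycle of length `k`. -/
def IsCycleOfLength {V : Type*} {G : SimpleGraph V} (C : G.Subgraph) (k : ℕ) : Prop :=
  3 ≤ k ∧ Nonempty (C.coe ≃g SimpleGraph.cycleGraph k)

end PackingColoring

namespace PackingColoring

/-! Colours 0 and 1 stand for the 1-packings, the special colours 2 and 3 for the 2-packings. The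
matching `M` pairs `C` with its complement, since both have `n` vertices. Once `C` is coloured, a
vertex whose mate on `C` has colour 0 or 1 gets the other of these two as its label, and it may take
its label or a special colour. Each remaining cycle of `F` must be coloured in this way, with
neighbours different and no special colour repeated at distance two.

If `n` is even and no 5-cycle lies off `C`, colour `C` alternately with 0 and 1. No special colour
lies on `C`, so the other cycles do not interact, and a cycle of length other than 5 can be coloured
for every labelling (`exists_cyclicColoring`).

Otherwise one vertex `u 0` of `C` gets colour 2 and the rest of `C` alternates. The mate of `u 0`
may take 0 or 1 freely, while its neighbours on its cycle and the mates of `u 1` and `u (n - 1)`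
must avoid 2. The cycle through the mate of `u 0` is handled by `exists_marked_cyclicColoring`: it
may have length 5 unless it contains both other mates, and if it contains both, their labels must
differ, which holds for odd `n`. On any other cycle one of these mates keeps its label, and
exchanging 2 and 3 if necessary frees the other from colour 2. If there is a 5-cycle off `C`, then
`n ≠ 5`, and `u 0` can be chosen with its mate on the 5-cycle and the mate of `u 1` off it.

The two statements on labelled cycles concern words of every length. A subset construction makes
them finite: the state after reading a word is a set of possible first two and last two colours, and
a search over all such states checks that the cycle can always be closed. -/

/-! ### The automaton on label words and the finite search. -/

/-- Letters of the words read by the automaton: letter `l` asks for the colour `l % 2` or for a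
special colour, which is `2` or `3` if `l < 2` and `3` otherwise. -/
def allowed (l z : ℕ) : Bool := z.beq 3 || (z.beq 2 && l.ble 1) || z.beq (l % 2)

/-- Consecutive colours `x, y, z` on a cycle: neighbours differ, and a special colour does not
reappear at distance two. -/
def window (x y z : ℕ) : Bool := !y.beq z && !(x.beq z && Nat.ble 2 x)

/-- Pairs `(4 * x + y, 4 * y + z)` for the admissible windows `x, y, z` with `z` allowed by `l`.
Windows with `y = 3` and `z = 2` are left out, as they are not needed. -/
def transitions (l : ℕ) : List (ℕ × ℕ) :=
  ((List.range 64).filter fun t => window (t / 16) (t / 4 % 4) (t % 4) && allowed l (t % 4) &&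
    !(Nat.beq (t % 16) 14)).map fun t => (t / 4, t % 16)

/-- The number whose set bits are the elements of `l`. -/
def bits (l : List ℕ) : ℕ := l.foldl (fun T i => Nat.lor T (Nat.shiftLeft 1 i)) 0

/-- The lists of transitions as closed terms, which the kernel evaluates only once. -/
def table : ℕ → List (ℕ × ℕ)
  | 0 => transitions 0
  | 1 => transitions 1
  | 2 => transitions 2
  | _ => transitions 3

/-- A set of quadruples `(a, b, x, y)` of colours is stored as a number whose bit
`16 * (4 * x + y) + (4 * a + b)` is set for the members. This is the set reached from `S` by
reading `l`, where `a, b` are the first two colours and `x, y` the last two. -/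
def readLetter (l S : ℕ) : ℕ :=
  (table l).foldl (fun T t => Nat.lor T
    (Nat.shiftLeft (Nat.mod (Nat.shiftRight S (Nat.mul 16 t.1)) 65536) (Nat.mul 16 t.2))) 0

/-- The quadruple with index `i` can be closed up to a cycle by one more letter `l`. -/
def closes (l i : ℕ) : Bool := (List.range 4).any fun z =>
  allowed l z && window (i / 64) (i / 16 % 4) z && window (i / 16 % 4) z (i / 4 % 4) &&
    window z (i / 4 % 4) (i % 4)

/-- Some member of `S` can be closed up to a cycle by the letter `l`. -/
def accepts (l S : ℕ) : Bool := !Nat.beq (Nat.land S (bits ((List.range 256).filter (closes l)))) 0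

/-- The quadruples `(a, b, a, b)` with `a ∈ A` and `b ≠ a` allowed by `l`. -/
def starts (A : List ℕ) (l : ℕ) : ℕ :=
  bits (((List.range 16).filter fun t =>
    A.contains (t / 4) && allowed l (t % 4) && !Nat.beq (t / 4) (t % 4)).map (17 * ·))

/-- A state: a truncated length, a record of the marked letters used so far, a set of quadruples. -/
abbrev State := ℕ × ℕ × ℕ

/-- The set of `s` is contained in that of `t`. Closing up a cycle is monotone in the set, so only
the smaller set has to be explored. -/
def dominates (s t : State) : Bool :=
  Nat.beq (Nat.land s.2.2 t.2.2) s.2.2 && s.1.beq t.1 && s.2.1.beq t.2.1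

/-- Adds a state to the queue and to the visited states unless it is dominated. -/
def push (q : List State × List State) (t : State) : List State × List State :=
  if q.2.any fun s => dominates s t then q else (t :: q.1, t :: q.2)

def successors (moves : ℕ → List (ℕ × ℕ)) (s : State) : List State :=
  (moves s.2.1).map fun m => (min (s.1 + 1) 3, m.2, readLetter m.1 s.2.2)

/-- The state is exempt, or a cycle can be closed after each final letter. -/
def stateOk (final : List ℕ) (exempt : State → Bool) (s : State) : Bool :=
  exempt s || final.all fun l => accepts l s.2.2

/-- Breadth first search: all states reached from the queue, up to domination, are `ok`. -/
def explore (moves : ℕ → List (ℕ × ℕ)) (ok : State → Bool) :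
    ℕ → List State → List State → List State → Bool
  | 0, _, _, _ => false
  | _ + 1, [], [], _ => true
  | k + 1, [], t :: w, vis => explore moves ok k (t :: w) [] vis
  | k + 1, s :: w, w', vis =>
    let q := (successors moves s).foldl push (w', vis)
    ok s && explore moves ok k w q.1 q.2

/-- Letters `3` and `2` are marked, and each is read at most once. -/
def movesB (f : ℕ) : List (ℕ × ℕ) :=
  [(0, f), (1, f)] ++ (if f.testBit 0 then [] else [(3, f + 1)]) ++
    (if f.testBit 1 then [] else [(2, f + 2)])

/-- Position 1 is a neighbour of the start, so its letter is always 2 or 3. The flag tells whether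
this position is also one of the two marked ones. -/
def initB : List State :=
  [(0, 0, starts [0, 1] 2), (0, 2, starts [0, 1] 2), (0, 0, starts [0, 1] 3), (0, 1, starts [0, 1] 3)]

def movesA (f : ℕ) : List (ℕ × ℕ) := [(0, f), (1, f)]

def initA : List State :=
  [(0, 0, starts [0] 0), (0, 0, starts [0] 1), (0, 0, starts [1] 0), (0, 0, starts [1] 1)]

/-- The first component of a state is the cycle length minus 3, capped at 3, so the value 2 singles
out length 5. There the claim fails: on a 5-cycle each special colour occurs at most once, and a
constant label can be kept at only two vertices. -/
theorem exploreA :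
    explore movesA (stateOk [0, 1] fun s => s.1.beq 2) 1000 initA [] initA = true := by
  decide +kernel

/-- Length 5 is exempt only if both marked letters have been read. The last letter is 2 or 3 because
the last position is again a neighbour of the start. -/
theorem exploreB :
    explore movesB (stateOk [2, 3] fun s => s.1.beq 2 && s.2.1.beq 3) 3000 initB [] initB = true := by
  decide +kernel

/-! ### Soundness of the sets of quadruples. -/

theorem testBit_foldl_lor {α : Type*} (f : α → ℕ) (l : List α) (T j : ℕ) :
    (l.foldl (fun T t => Nat.lor T (f t)) T).testBit j = true ↔
      T.testBit j = true ∨ ∃ t ∈ l, (f t).testBit j = true := by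
  induction l generalizing T with
  | nil => simp
  | cons t l ih =>
    rw [List.foldl_cons, ih]
    have : (Nat.lor T (f t)).testBit j = (T.testBit j || (f t).testBit j) := Nat.testBit_or ..
    simp only [this, Bool.or_eq_true, List.mem_cons, exists_eq_or_imp, or_assoc]

theorem testBit_bits (l : List ℕ) (j : ℕ) : (bits l).testBit j = true ↔ j ∈ l := by
  unfold bits
  rw [testBit_foldl_lor]
  have h (t : ℕ) : Nat.shiftLeft 1 t = 2 ^ t := Nat.one_shiftLeft t
  simp only [h, Nat.testBit_two_pow]
  simp

theorem mem_table {l : ℕ} (hl : l < 4) {t : ℕ × ℕ} (ht : t ∈ table l) : t ∈ transitions l := by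
  interval_cases l <;> exact ht

theorem testBit_readLetter {l S j : ℕ} (hl : l < 4) (h : (readLetter l S).testBit j = true) :
    ∃ u r, u < 64 ∧ r < 16 ∧ j = 16 * (u % 16) + r ∧ S.testBit (16 * (u / 4) + r) = true ∧
      window (u / 16) (u / 4 % 4) (u % 4) = true ∧ allowed l (u % 4) = true := by
  unfold readLetter at h
  rw [testBit_foldl_lor] at h
  obtain h | ⟨t, ht, h⟩ := h
  · simp at h
  have ht := mem_table hl ht
  simp only [transitions, List.mem_map, List.mem_filter, List.mem_range, Bool.and_eq_true] at ht
  obtain ⟨u, ⟨hu, ⟨hw, ha⟩, -⟩, rfl⟩ := ht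
  have e : (Nat.shiftLeft (Nat.mod (Nat.shiftRight S (Nat.mul 16 (u / 4))) 65536)
      (Nat.mul 16 (u % 16))) = ((S >>> (16 * (u / 4))) % 2 ^ 16) <<< (16 * (u % 16)) := rfl
  simp only [e, Nat.testBit_shiftLeft, Nat.testBit_mod_two_pow, Nat.testBit_shiftRight,
    Bool.and_eq_true, decide_eq_true_eq] at h
  exact ⟨u, j - 16 * (u % 16), hu, h.2.1, by omega, h.2.2, hw, ha⟩

/-- `c` colours the positions `0, …, k + 1` as required by the word `L`, starting in `A`. -/
structure IsRun (A : List ℕ) (L : ℕ → ℕ) (k : ℕ) (c : ℕ → ℕ) : Prop where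
  lt : ∀ i, c i < 4
  start : c 0 ∈ A
  ne : c 0 ≠ c 1
  allowed : ∀ i ≤ k, allowed (L (i + 1)) (c (i + 1)) = true
  window : ∀ i < k, window (c i) (c (i + 1)) (c (i + 2)) = true

theorem IsRun.extend {A : List ℕ} {L : ℕ → ℕ} {k z : ℕ} {c : ℕ → ℕ} (h : IsRun A L k c)
    (hz : z < 4) (hw : PackingColoring.window (c k) (c (k + 1)) z = true)
    (ha : PackingColoring.allowed (L (k + 2)) z = true) :
    IsRun A L (k + 1) (Function.update c (k + 2) z) := by
  have e (i : ℕ) (hi : i ≤ k + 1) : Function.update c (k + 2) z i = c i :=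
    Function.update_of_ne (by omega) _ _
  refine ⟨fun i => ?_, ?_, ?_, fun i hi => ?_, fun i hi => ?_⟩
  · rw [Function.update_apply]
    split_ifs
    exacts [hz, h.lt i]
  · rw [e 0 (by omega)]; exact h.start
  · rw [e 0 (by omega), e 1 (by omega)]; exact h.ne
  · obtain hi | rfl := Nat.le_succ_iff.1 hi
    · rw [e _ (by omega)]; exact h.allowed i hi
    · rw [Function.update_self]; exact ha
  · obtain hi | rfl := Nat.lt_succ_iff_lt_or_eq.1 hi
    · rw [e _ (by omega), e _ (by omega), e _ (by omega)]; exact h.window i hi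
    · rw [e _ (by omega), e _ (by omega), Function.update_self]; exact hw

/-- Every quadruple of the set `S` comes from a run of length `k`. -/
def Realized (A : List ℕ) (L : ℕ → ℕ) (k S : ℕ) : Prop :=
  ∀ i, S.testBit i = true → ∃ c, IsRun A L k c ∧ c 0 = i / 4 % 4 ∧ c 1 = i % 4 ∧
    c k = i / 64 ∧ c (k + 1) = i / 16 % 4

theorem Realized.starts (A : List ℕ) (L : ℕ → ℕ) : Realized A L 0 (starts A (L 1)) := by
  intro i hi
  simp only [PackingColoring.starts, testBit_bits, List.mem_map, List.mem_filter, List.mem_range,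
    Bool.and_eq_true, Bool.not_eq_true', List.contains_iff_mem] at hi
  obtain ⟨t, ⟨ht, ⟨hA, ha⟩, hne⟩, rfl⟩ := hi
  have hne : t / 4 ≠ t % 4 := fun h => by simp [h] at hne
  refine ⟨fun n => if n = 0 then t / 4 else t % 4, ⟨fun n => ?_, hA, hne, fun n hn => ?_,
    fun n hn => by omega⟩, ?_, ?_, ?_, ?_⟩
  · split_ifs <;> omega
  · obtain rfl : n = 0 := by omega
    simpa using ha
  all_goals clear hne hA ha; interval_cases t <;> rfl

theorem Realized.readLetter {A : List ℕ} {L : ℕ → ℕ} {k S : ℕ} (h : Realized A L k S)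
    (hl : L (k + 2) < 4) : Realized A L (k + 1) (readLetter (L (k + 2)) S) := by
  intro j hj
  obtain ⟨u, r, hu, hr, rfl, hS, hw, ha⟩ := testBit_readLetter hl hj
  obtain ⟨c, hc, h0, h1, h2, h3⟩ := h _ hS
  have e2 : c k = u / 16 := by omega
  have e3 : c (k + 1) = u / 4 % 4 := by omega
  have e (i : ℕ) (hi : i ≤ k + 1) : Function.update c (k + 2) (u % 4) i = c i :=
    Function.update_of_ne (by omega) _ _
  refine ⟨_, hc.extend (by omega) (by rwa [e2, e3]) ha, ?_, ?_, ?_, ?_⟩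
  · rw [e _ (by omega)]; omega
  · rw [e _ (by omega)]; omega
  · rw [e _ (by omega)]; omega
  · rw [Function.update_self]; omega

theorem Realized.mono {A : List ℕ} {L : ℕ → ℕ} {k S T : ℕ} (h : Realized A L k T)
    (hST : Nat.land S T = S) : Realized A L k S := by
  intro i hi
  refine h i ?_
  rw [← hST] at hi
  have : (Nat.land S T).testBit i = (S.testBit i && T.testBit i) := Nat.testBit_and ..
  rw [this, Bool.and_eq_true] at hi
  exact hi.2

/-- A run that closes up to a coloring of a cycle. -/
theorem Realized.exists_closed {A : List ℕ} {L : ℕ → ℕ} {k S : ℕ} (h : Realized A L k S)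
    (hS : accepts (L (k + 2)) S = true) :
    ∃ c, IsRun A L (k + 1) c ∧ window (c (k + 1)) (c (k + 2)) (c 0) = true ∧
      window (c (k + 2)) (c 0) (c 1) = true := by
  have hne : Nat.land S (bits ((List.range 256).filter (closes (L (k + 2))))) ≠ 0 := by
    intro h0
    rw [accepts, h0] at hS
    exact Bool.noConfusion hS
  obtain ⟨i, hi⟩ := Nat.exists_testBit_of_ne_zero hne
  have e : (Nat.land S (bits ((List.range 256).filter (closes (L (k + 2)))))).testBit i =
    (S.testBit i && (bits ((List.range 256).filter (closes (L (k + 2))))).testBit i) :=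
      Nat.testBit_and ..
  rw [e, Bool.and_eq_true, testBit_bits, List.mem_filter] at hi
  obtain ⟨hiS, -, hcl⟩ := hi
  obtain ⟨c, hc, h0, h1, h2, h3⟩ := h _ hiS
  simp only [closes, List.any_eq_true, List.mem_range, Bool.and_eq_true] at hcl
  obtain ⟨z, hz, ⟨⟨ha, hw1⟩, hw2⟩, hw3⟩ := hcl
  rw [← h0, ← h1] at *
  have e (i : ℕ) (hi : i ≤ k + 1) : Function.update c (k + 2) z i = c i :=
    Function.update_of_ne (by omega) _ _
  refine ⟨_, hc.extend hz (by rwa [h2, h3]) ha, ?_, ?_⟩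
  · rw [e _ (by omega), e 0 (by omega), Function.update_self, h3]; exact hw2
  · rw [e 0 (by omega), e 1 (by omega), Function.update_self]; exact hw3

/-! ### Soundness of the search. -/

theorem dominates_iff {s t : State} :
    dominates s t = true ↔ Nat.land s.2.2 t.2.2 = s.2.2 ∧ s.1 = t.1 ∧ s.2.1 = t.2.1 := by
  simp [dominates, and_assoc, Nat.beq_eq]

theorem dominates_refl (s : State) : dominates s s = true :=
  dominates_iff.2 ⟨Nat.and_self _, rfl, rfl⟩

theorem foldl_push (l : List State) (q : List State × List State) :
    (∀ s ∈ q.1, s ∈ (l.foldl push q).1) ∧ (∀ s ∈ q.2, s ∈ (l.foldl push q).2) ∧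
      (∀ s ∈ (l.foldl push q).2, s ∈ q.2 ∨ s ∈ (l.foldl push q).1) ∧
      ∀ t ∈ l, ∃ s ∈ (l.foldl push q).2, dominates s t = true := by
  induction l generalizing q with
  | nil => exact ⟨fun _ h => h, fun _ h => h, fun _ h => Or.inl h, by simp⟩
  | cons t l ih =>
    obtain ⟨h1, h2, h3, h4⟩ := ih (push q t)
    rw [List.foldl_cons]
    by_cases hd : q.2.any (fun s => dominates s t) = true
    · have e : push q t = q := if_pos hd
      rw [e] at h1 h2 h3 h4 ⊢
      refine ⟨h1, h2, h3, fun u hu => ?_⟩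
      obtain rfl | hu := List.mem_cons.1 hu
      · obtain ⟨s, hs, hst⟩ := List.any_eq_true.1 hd
        exact ⟨s, h2 s hs, hst⟩
      · exact h4 u hu
    · have e : push q t = (t :: q.1, t :: q.2) := if_neg hd
      rw [e] at h1 h2 h3 h4 ⊢
      refine ⟨fun s hs => h1 s (List.mem_cons_of_mem _ hs),
        fun s hs => h2 s (List.mem_cons_of_mem _ hs), fun s hs => ?_, fun u hu => ?_⟩
      · obtain hs | hs := h3 s hs
        · obtain rfl | hs := List.mem_cons.1 hs
          · exact Or.inr (h1 _ List.mem_cons_self)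
          · exact Or.inl hs
        · exact Or.inr hs
      · obtain rfl | hu := List.mem_cons.1 hu
        · exact ⟨u, h2 _ List.mem_cons_self, dominates_refl u⟩
        · exact h4 u hu

/-- Invariant: a visited state is still queued, or it is ok and each of its successors is dominated
by a visited state. When both queues are empty, the visited states are closed under moves up to
domination, which covers words of every length. -/
theorem exists_closed_of_explore {moves : ℕ → List (ℕ × ℕ)} {ok : State → Bool} (fuel : ℕ)
    (w w' vis : List State) (h : explore moves ok fuel w w' vis = true)
    (hvis : ∀ s ∈ vis, s ∈ w ∨ s ∈ w' ∨
      (ok s = true ∧ ∀ t ∈ successors moves s, ∃ r ∈ vis, dominates r t = true)) :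
    ∃ R : List State, (∀ s ∈ vis, s ∈ R) ∧
      ∀ s ∈ R, ok s = true ∧ ∀ t ∈ successors moves s, ∃ r ∈ R, dominates r t = true := by
  induction fuel generalizing w w' vis with
  | zero => simp [explore] at h
  | succ k ih =>
    match w, w' with
    | [], [] => exact ⟨vis, fun s hs => hs, fun s hs => by simpa using hvis s hs⟩
    | [], t :: w =>
      rw [explore] at h
      exact ih _ _ _ h fun s hs => by
        obtain h | h | h := hvis s hs
        · simp at h
        · exact Or.inl h
        · exact Or.inr (Or.inr h)
    | s :: w, w' =>
      rw [explore] at h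
      simp only [Bool.and_eq_true] at h
      obtain ⟨h1, h2, h3, h4⟩ := foldl_push (successors moves s) (w', vis)
      obtain ⟨R, hR, hR'⟩ := ih _ _ _ h.2 fun t ht => by
        obtain ht | ht := h3 t ht
        · obtain hw | hw | hw := hvis t ht
          · obtain rfl | hw := List.mem_cons.1 hw
            · exact Or.inr (Or.inr ⟨h.1, h4⟩)
            · exact Or.inl hw
          · exact Or.inr (Or.inl (h1 _ hw))
          · refine Or.inr (Or.inr ⟨hw.1, fun u hu => ?_⟩)
            obtain ⟨r, hr, hru⟩ := hw.2 u hu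
            exact ⟨r, h2 r hr, hru⟩
        · exact Or.inr (Or.inl ht)
      exact ⟨R, fun t ht => hR t (h2 t ht), hR'⟩

/-- A word that the automaton can follow has a coloring of the cycle of length `K + 3`. -/
theorem exists_coloring_of_explore {moves : ℕ → List (ℕ × ℕ)} {final : List ℕ}
    {exempt : State → Bool} {fuel : ℕ} {init : List State}
    (h : explore moves (stateOk final exempt) fuel init [] init = true)
    (A : List ℕ) (L fl : ℕ → ℕ) (K : ℕ) (hinit : (0, fl 0, starts A (L 1)) ∈ init)
    (hmoves : ∀ k < K, (L (k + 2), fl (k + 1)) ∈ moves (fl k)) (hL : ∀ i, L i < 4)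
    (hfinal : L (K + 2) ∈ final) (hexempt : ∀ S, exempt (min K 3, fl K, S) = false) :
    ∃ c : ℕ → ℕ, (∀ i, c i < 4) ∧ (∀ i, window (c i) (c (i + 1)) (c (i + 2)) = true) ∧
      (∀ i, c (i + (K + 3)) = c i) ∧ c 0 ∈ A ∧
      ∀ i, 1 ≤ i → i < K + 3 → allowed (L i) (c i) = true := by
  obtain ⟨R, hR, hR'⟩ := exists_closed_of_explore fuel init [] init h fun s hs => Or.inl hs
  -- Only one inclusion is needed: quadruples in `S` come from runs, but `S` may miss some. Hence
  -- passing to a dominating state and omitting transitions are both harmless.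
  have key : ∀ k ≤ K, ∃ S, (min k 3, fl k, S) ∈ R ∧ Realized A L k S := by
    intro k hk
    induction k with
    | zero => exact ⟨_, hR _ hinit, Realized.starts A L⟩
    | succ k ih =>
      obtain ⟨S, hS, hr⟩ := ih (by omega)
      obtain ⟨⟨a, b, T⟩, hrR, hrd⟩ := (hR' _ hS).2 (min (min k 3 + 1) 3, fl (k + 1), readLetter (L (k + 2)) S)
        (List.mem_map.2 ⟨_, hmoves k (by omega), rfl⟩)
      obtain ⟨h1, h2, h3⟩ := dominates_iff.1 hrd
      dsimp only at h1 h2 h3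
      have : min (min k 3 + 1) 3 = min (k + 1) 3 := by omega
      rw [h2, h3, this] at hrR
      exact ⟨T, hrR, (hr.readLetter (hL _)).mono h1⟩
  obtain ⟨S, hS, hr⟩ := key K le_rfl
  have hok := (hR' _ hS).1
  rw [stateOk, hexempt, Bool.false_or, List.all_eq_true] at hok
  obtain ⟨c, hc, hw1, hw2⟩ := hr.exists_closed (hok _ hfinal)
  refine ⟨fun i => c (i % (K + 3)), fun i => hc.lt _, fun i => ?_, fun i => by simp, ?_,
    fun i hi hi' => ?_⟩
  · have hm : i % (K + 3) < K + 3 := Nat.mod_lt _ (by omega)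
    have e (j : ℕ) : (i + j) % (K + 3) = (i % (K + 3) + j) % (K + 3) := by simp
    dsimp only
    rw [e 1, e 2]
    generalize i % (K + 3) = r at *
    obtain hr | rfl | rfl : r < K + 1 ∨ r = K + 1 ∨ r = K + 2 := by omega
    · rw [Nat.mod_eq_of_lt (by omega), Nat.mod_eq_of_lt (by omega)]
      exact hc.window r hr
    · rw [Nat.mod_eq_of_lt (by omega), Nat.mod_self]
      exact hw1
    · have : (K + 2 + 2) % (K + 3) = 1 := by
        rw [show K + 2 + 2 = 1 + (K + 3) by omega, Nat.add_mod_right, Nat.mod_eq_of_lt (by omega)]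
      rw [Nat.mod_self, this]
      exact hw2
  · simpa using hc.start
  · obtain ⟨j, rfl⟩ := Nat.exists_eq_add_of_le' hi
    dsimp only
    rw [Nat.mod_eq_of_lt hi']
    exact hc.allowed j (by omega)

/-! ### Colourings of labelled cycles. -/

/-- `c` is a proper `m`-periodic coloring with colours `0, 1, 2, 3` in which the special colours
`2, 3` do not reappear at distance two. -/
structure IsCyclicColoring (m : ℕ) (c : ℕ → ℕ) : Prop where
  lt : ∀ i, c i < 4
  periodic : ∀ i, c (i + m) = c i
  ne : ∀ i, c i ≠ c (i + 1)
  special : ∀ i, 2 ≤ c i → c i ≠ c (i + 2)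

theorem beq_eq_false_iff {a b : ℕ} : a.beq b = false ↔ a ≠ b := by
  rw [← Bool.not_eq_true, Nat.beq_eq]

theorem window_iff {x y z : ℕ} : window x y z = true ↔ y ≠ z ∧ (2 ≤ x → x ≠ z) := by
  simp only [window, Bool.and_eq_true, Bool.not_eq_true', Bool.and_eq_false_iff, beq_eq_false_iff,
    ← Bool.not_eq_true (Nat.ble 2 x), Nat.ble_eq]
  tauto

theorem isCyclicColoring_of_window {m : ℕ} {c : ℕ → ℕ} (hm : 1 ≤ m) (hlt : ∀ i, c i < 4)
    (hw : ∀ i, window (c i) (c (i + 1)) (c (i + 2)) = true) (hp : ∀ i, c (i + m) = c i) :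
    IsCyclicColoring m c where
  lt := hlt
  periodic := hp
  ne i := by
    -- A window compares only its last two entries as neighbours, so the window starting one step
    -- back is used, that is, at `i + (m - 1)`.
    obtain ⟨k, rfl⟩ := Nat.exists_eq_add_of_le' hm
    have := (window_iff.1 (hw (i + k))).1
    rwa [show i + k + 1 = i + (k + 1) by ring, hp, show i + k + 2 = i + 1 + (k + 1) by ring, hp]
      at this
  special i := (window_iff.1 (hw i)).2

theorem allowed_iff {l z : ℕ} :
    allowed l z = true ↔ z = 3 ∨ (z = 2 ∧ l ≤ 1) ∨ z = l % 2 := by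
  simp [allowed, Nat.beq_eq, or_assoc]

theorem exists_cyclicColoring {m : ℕ} (hm : 3 ≤ m) (hm5 : m ≠ 5) (lab : ℕ → ℕ)
    (hlab : ∀ i, lab i < 2) :
    ∃ c, IsCyclicColoring m c ∧ c 0 = lab 0 ∧ ∀ i < m, c i = lab i ∨ 2 ≤ c i := by
  obtain ⟨K, rfl⟩ := Nat.exists_eq_add_of_le' hm
  have hlab' (i : ℕ) : lab i = 0 ∨ lab i = 1 := by have := hlab i; omega
  obtain ⟨c, h1, h2, h3, h4, h5⟩ := exists_coloring_of_explore exploreA [lab 0] lab (fun _ => 0) K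
    (by obtain h | h := hlab' 0 <;> obtain h' | h' := hlab' 1 <;> rw [h, h'] <;> simp [initA])
    (fun k _ => by obtain h | h := hlab' (k + 2) <;> simp [movesA, h])
    (fun i => (hlab i).trans (by norm_num))
    (by obtain h | h := hlab' (K + 2) <;> simp [h])
    (fun S => by
      dsimp only
      rw [beq_eq_false_iff]
      omega)
  have h0 : c 0 = lab 0 := by simpa using h4
  refine ⟨c, isCyclicColoring_of_window (by omega) h1 h2 h3, h0, fun i hi => ?_⟩
  obtain rfl | hi0 := Nat.eq_zero_or_pos i
  · exact Or.inl h0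
  · have := allowed_iff.1 (h5 i hi0 hi)
    have := hlab i
    omega

/-- The first vertex gets `0` or `1`, its neighbours and two marked vertices avoid the colour `2`. -/
theorem exists_marked_cyclicColoring {m p q : ℕ} (hm : 3 ≤ m) (lab : ℕ → ℕ)
    (hlab : ∀ i, lab i < 2) (hp0 : 1 ≤ p) (hq0 : 1 ≤ q) (hp : p < m → lab p = 1)
    (hq : q < m → lab q = 0) (hm5 : m = 5 → m ≤ p ∨ m ≤ q) :
    ∃ c, IsCyclicColoring m c ∧ c 0 < 2 ∧ c 1 ≠ 2 ∧ c (m - 1) ≠ 2 ∧ (p < m → c p ≠ 2) ∧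
      (q < m → c q ≠ 2) ∧ ∀ i, 1 ≤ i → i < m → c i = lab i ∨ 2 ≤ c i := by
  obtain ⟨K, rfl⟩ := Nat.exists_eq_add_of_le' hm
  have hlab' (i : ℕ) : lab i = 0 ∨ lab i = 1 := by have := hlab i; omega
  let mark : ℕ → Prop := fun i => i = 1 ∨ i = K + 2 ∨ i = p ∨ i = q
  classical
  let L : ℕ → ℕ := fun i => if mark i then lab i + 2 else lab i
  -- After `k` moves the positions up to `k + 1` are coloured; the two bits record whether `p` and
  -- `q` are among them.
  let fl : ℕ → ℕ := fun k => (if p ≤ k + 1 then 1 else 0) + (if q ≤ k + 1 then 2 else 0)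
  have hpq : ∀ i < K + 3, i = p → i ≠ q := by
    rintro i hi rfl rfl
    have := hp hi
    have := hq hi
    omega
  obtain ⟨c, h1, h2, h3, h4, h5⟩ := exists_coloring_of_explore exploreB [0, 1] L fl K
    (by
      have hL : L 1 = lab 1 + 2 := if_pos (Or.inl rfl)
      rw [hL]
      by_cases h : p = 1
      · have h' : q ≠ 1 := fun h' => hpq 1 (by omega) h.symm h'.symm
        have e : fl 0 = 1 := by simp only [fl]; split_ifs <;> omega
        have := hp (by omega)
        rw [h] at this
        rw [e, this]
        simp [initB]
      · by_cases h' : q = 1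
        · have e : fl 0 = 2 := by simp only [fl]; split_ifs <;> omega
          have := hq (by omega)
          rw [h'] at this
          rw [e, this]
          simp [initB]
        · have e : fl 0 = 0 := by simp only [fl]; split_ifs <;> omega
          rw [e]
          obtain h | h := hlab' 1 <;> rw [h] <;> simp [initB])
    (fun k hk => by
      by_cases h : k + 2 = p
      · have h' := hpq (k + 2) (by omega) h
        have hL : L (k + 2) = 3 := by
          have : L (k + 2) = lab (k + 2) + 2 := if_pos (Or.inr (Or.inr (Or.inl h)))
          rw [this, h, hp (by omega)]
        rw [hL]
        by_cases hqk : q ≤ k + 1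
        · have e1 : fl k = 2 := by simp only [fl]; split_ifs <;> omega
          have e2 : fl (k + 1) = 3 := by simp only [fl]; split_ifs <;> omega
          rw [e1, e2]; decide
        · have e1 : fl k = 0 := by simp only [fl]; split_ifs <;> omega
          have e2 : fl (k + 1) = 1 := by simp only [fl]; split_ifs <;> omega
          rw [e1, e2]; decide
      · by_cases h' : k + 2 = q
        · have hL : L (k + 2) = 2 := by
            have : L (k + 2) = lab (k + 2) + 2 := if_pos (Or.inr (Or.inr (Or.inr h')))
            rw [this, h', hq (by omega)]
          rw [hL]
          by_cases hpk : p ≤ k + 1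
          · have e1 : fl k = 1 := by simp only [fl]; split_ifs <;> omega
            have e2 : fl (k + 1) = 3 := by simp only [fl]; split_ifs <;> omega
            rw [e1, e2]; decide
          · have e1 : fl k = 0 := by simp only [fl]; split_ifs <;> omega
            have e2 : fl (k + 1) = 2 := by simp only [fl]; split_ifs <;> omega
            rw [e1, e2]; decide
        · have hL : L (k + 2) = lab (k + 2) := if_neg (by simp only [mark]; omega)
          have e : fl (k + 1) = fl k := by simp only [fl]; split_ifs <;> omega
          rw [hL, e]
          obtain h | h := hlab' (k + 2) <;> simp [movesB, h])
    (fun i => by simp only [L]; have := hlab i; split_ifs <;> omega)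
    (by
      have hL : L (K + 2) = lab (K + 2) + 2 := if_pos (Or.inr (Or.inl rfl))
      rw [hL]
      obtain h | h := hlab' (K + 2) <;> simp [h])
    (fun S => by
      dsimp only
      rw [Bool.and_eq_false_iff, beq_eq_false_iff, beq_eq_false_iff]
      simp only [fl]
      split_ifs <;> omega)
  have hmark (i : ℕ) (hi : 1 ≤ i) (hi' : i < K + 3) (h : mark i) : c i ≠ 2 := by
    have := allowed_iff.1 (h5 i hi hi')
    have e : L i = lab i + 2 := if_pos h
    have := hlab i
    omega
  refine ⟨c, isCyclicColoring_of_window (by omega) h1 h2 h3, ?_,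
    hmark 1 le_rfl (by omega) (Or.inl rfl), hmark (K + 2) (by omega) (by omega) (Or.inr (Or.inl rfl)),
    fun h => hmark p hp0 h (Or.inr (Or.inr (Or.inl rfl))),
    fun h => hmark q hq0 h (Or.inr (Or.inr (Or.inr rfl))), fun i hi hi' => ?_⟩
  · simp at h4
    omega
  · have := allowed_iff.1 (h5 i hi hi')
    have := hlab i
    have : L i = lab i ∨ L i = lab i + 2 := by
      simp only [L]; split_ifs <;> simp
    omega

/-! ### Periodic parametrizations of the cycles of a 2-regular graph. -/

variable {V : Type*}

/-- `x` runs periodically through a cycle of length `m` of `H`. -/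
structure IsCycleParam (H : SimpleGraph V) (m : ℕ) (x : ℕ → V) : Prop where
  three_le : 3 ≤ m
  eq_iff : ∀ i j, x i = x j ↔ i % m = j % m
  adj : ∀ i, H.Adj (x i) (x (i + 1))

theorem succ_mod_cases {m : ℕ} (hm : 0 < m) (i : ℕ) :
    (i % m + 1 < m ∧ (i + 1) % m = i % m + 1) ∨ (i % m + 1 = m ∧ (i + 1) % m = 0) := by
  have h := Nat.mod_lt i hm
  rw [← Nat.mod_add_mod]
  obtain h | h : i % m + 1 < m ∨ i % m + 1 = m := by omega
  · exact Or.inl ⟨h, Nat.mod_eq_of_lt h⟩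
  · exact Or.inr ⟨h, by rw [h, Nat.mod_self]⟩

namespace IsCycleParam

variable {H : SimpleGraph V} {m : ℕ} {x : ℕ → V}

theorem shift (h : IsCycleParam H m x) (s : ℕ) : IsCycleParam H m fun i => x (i + s) where
  three_le := h.three_le
  eq_iff i j := by
    rw [h.eq_iff]
    exact ⟨fun e => Nat.ModEq.add_right_cancel' s e, fun e => Nat.ModEq.add_right s e⟩
  adj i := by
    rw [add_right_comm]
    exact h.adj _

theorem mod_apply (h : IsCycleParam H m x) (i : ℕ) : x (i % m) = x i :=
  (h.eq_iff _ _).2 (Nat.mod_mod _ _)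

theorem add_period (h : IsCycleParam H m x) (i : ℕ) : x (i + m) = x i :=
  (h.eq_iff _ _).2 (Nat.add_mod_right _ _)

theorem adj_pred (h : IsCycleParam H m x) (i : ℕ) : H.Adj (x i) (x (i + (m - 1))) := by
  have h3 := h.three_le
  have := h.adj (i + (m - 1))
  rw [show i + (m - 1) + 1 = i + m by omega, h.add_period] at this
  exact this.symm

theorem eq_or_eq_of_adj [Finite V] (h : IsCycleParam H m x)
    (hH : ∀ v, (H.neighborSet v).ncard = 2) {i : ℕ} {w : V} (hw : H.Adj (x i) w) :
    w = x (i + 1) ∨ w = x (i + (m - 1)) := by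
  have h3 := h.three_le
  have hne : x (i + 1) ≠ x (i + (m - 1)) := by
    rw [Ne, h.eq_iff]
    intro e
    have : 1 % m = (m - 1) % m := Nat.ModEq.add_left_cancel' i e
    rw [Nat.mod_eq_of_lt (by omega), Nat.mod_eq_of_lt (by omega)] at this
    omega
  have hsub : ({x (i + 1), x (i + (m - 1))} : Set V) ⊆ H.neighborSet (x i) := by
    rintro _ (rfl | rfl)
    exacts [h.adj i, h.adj_pred i]
  have := Set.eq_of_subset_of_ncard_le hsub (by rw [hH, Set.ncard_pair hne])
  have hw' : w ∈ ({x (i + 1), x (i + (m - 1))} : Set V) := by rw [this]; exact hw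
  simpa using hw'

theorem mem_range_of_reachable [Finite V] (h : IsCycleParam H m x)
    (hH : ∀ v, (H.neighborSet v).ncard = 2) {w : V} (hw : H.Reachable (x 0) w) :
    w ∈ Set.range x := by
  obtain ⟨p⟩ := hw
  suffices ∀ (a b : V) (_ : H.Walk a b), a ∈ Set.range x → b ∈ Set.range x from
    this _ _ p ⟨0, rfl⟩
  intro a b p
  induction p with
  | nil => exact id
  | cons hadj _ ih =>
    rintro ⟨i, rfl⟩
    obtain rfl | rfl := h.eq_or_eq_of_adj hH hadj
    exacts [ih ⟨_, rfl⟩, ih ⟨_, rfl⟩]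

theorem reachable (h : IsCycleParam H m x) (i : ℕ) : H.Reachable (x 0) (x i) := by
  induction i with
  | zero => exact SimpleGraph.Reachable.refl _
  | succ i ih => exact ih.trans (h.adj i).reachable

theorem ncard_range (h : IsCycleParam H m x) : (Set.range x).ncard = m := by
  have : Set.range x = x '' Set.Iio m := by
    ext v
    constructor
    · rintro ⟨i, rfl⟩
      exact ⟨i % m, Nat.mod_lt _ (by have := h.three_le; omega), h.mod_apply i⟩
    · rintro ⟨i, -, rfl⟩
      exact ⟨i, rfl⟩
  rw [this, Set.InjOn.ncard_image, ← Finset.coe_Iio, Set.ncard_coe_finset, Nat.card_Iio]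
  intro i hi j hj e
  have := (h.eq_iff i j).1 e
  rwa [Nat.mod_eq_of_lt hi, Nat.mod_eq_of_lt hj] at this

end IsCycleParam

theorem exists_isCycleParam [Finite V] {H : SimpleGraph V}
    (hH : ∀ v, (H.neighborSet v).ncard = 2) (v : V) :
    ∃ m x, IsCycleParam H m x ∧ x 0 = v := by
  have hcyc : H.IsCycles := fun w _ => hH w
  obtain ⟨p, hp, -⟩ := hcyc.exists_cycle_toSubgraph_verts_eq_connectedComponentSupp
    (c := H.connectedComponentMk v) (v := v) rfl (Set.nonempty_of_ncard_ne_zero (by rw [hH]; simp))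
  have h3 := hp.three_le_length
  refine ⟨p.length, fun i => p.getVert (i % p.length), ⟨h3, fun i j => ?_, fun i => ?_⟩, by simp⟩
  · refine ⟨fun h => ?_, fun h => by rw [h]⟩
    have hi := Nat.mod_lt i (show p.length > 0 by omega)
    have hj := Nat.mod_lt j (show p.length > 0 by omega)
    exact hp.getVert_injOn' (by simp only [Set.mem_ofPred_eq]; omega)
      (by simp only [Set.mem_ofPred_eq]; omega) h
  · obtain ⟨h, e⟩ | ⟨h, e⟩ := succ_mod_cases (show 0 < p.length by omega) i
    · rw [e]
      exact p.adj_getVert_succ (by omega)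
    · have := p.adj_getVert_succ (i := i % p.length) (by omega)
      rw [e, SimpleGraph.Walk.getVert_zero]
      rwa [h, SimpleGraph.Walk.getVert_length] at this

theorem fin_sub_val_eq_one_iff {m : ℕ} (hm : 3 ≤ m) (i j : Fin m) :
    (i - j).val = 1 ↔ (j.val + 1) % m = i.val := by
  have hi := i.isLt
  have hj := j.isLt
  rw [Fin.sub_def]
  dsimp only
  obtain h | h : j.val + 1 < m ∨ j.val + 1 = m := by omega
  · rw [Nat.mod_eq_of_lt h]
    obtain h' | h' : i.val < j.val ∨ j.val ≤ i.val := by omega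
    · rw [Nat.mod_eq_of_lt (by omega)]; omega
    · rw [show m - j.val + i.val = (i.val - j.val) + m by omega, Nat.add_mod_right,
        Nat.mod_eq_of_lt (by omega)]
      omega
  · rw [h, Nat.mod_self, show m - j.val + i.val = i.val + 1 by omega]
    obtain h' | h' : i.val + 1 < m ∨ i.val + 1 = m := by omega
    · rw [Nat.mod_eq_of_lt h']; omega
    · rw [h', Nat.mod_self]; omega

theorem cycleGraph_adj_iff {m : ℕ} (hm : 3 ≤ m) (i j : Fin m) :
    (SimpleGraph.cycleGraph m).Adj i j ↔ (i.val + 1) % m = j.val ∨ (j.val + 1) % m = i.val := by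
  rw [SimpleGraph.cycleGraph_adj', fin_sub_val_eq_one_iff hm, fin_sub_val_eq_one_iff hm, or_comm]

/-- A cycle contained in `F` has a parametrization. -/
theorem IsCycleOfLength.exists_isCycleParam {G : SimpleGraph V} {F C : G.Subgraph} {n : ℕ}
    (hC : IsCycleOfLength C n) (hCF : C ≤ F) :
    ∃ u, IsCycleParam F.spanningCoe n u ∧ Set.range u = C.verts := by
  obtain ⟨h3, ⟨e⟩⟩ := hC
  have hlt (i : ℕ) : i % n < n := Nat.mod_lt _ (by omega)
  refine ⟨fun i => (e.symm ⟨i % n, hlt i⟩ : V), ⟨h3, fun i j => ?_, fun i => ?_⟩, ?_⟩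
  · rw [← Subtype.ext_iff, e.symm.injective.eq_iff, Fin.mk.injEq]
  · rw [SimpleGraph.Subgraph.spanningCoe_adj]
    refine hCF.2 ?_
    have : C.coe.Adj (e.symm ⟨i % n, hlt i⟩) (e.symm ⟨(i + 1) % n, hlt _⟩) := by
      rw [e.symm.map_adj_iff, cycleGraph_adj_iff h3]
      exact Or.inl (Nat.mod_add_mod _ _ _)
    exact this
  · ext v
    constructor
    · rintro ⟨i, rfl⟩
      exact Subtype.coe_prop _
    · intro hv
      refine ⟨e ⟨v, hv⟩, ?_⟩
      have : (⟨(e ⟨v, hv⟩ : Fin n) % n, hlt _⟩ : Fin n) = e ⟨v, hv⟩ :=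
        Fin.ext (Nat.mod_eq_of_lt (Fin.isLt _))
      dsimp only
      rw [this, e.symm_apply_apply]

/-- A parametrized cycle of `F` spans a subgraph which is a cycle. -/
theorem IsCycleParam.isCycleOfLength_induce [Finite V] {G : SimpleGraph V} {F : G.Subgraph} {m : ℕ}
    {x : ℕ → V} (h : IsCycleParam F.spanningCoe m x)
    (hF : ∀ v, (F.spanningCoe.neighborSet v).ncard = 2) :
    IsCycleOfLength (F.induce (Set.range x)) m := by
  have h3 := h.three_le
  refine ⟨h3, ⟨RelIso.symm ⟨Equiv.ofBijective
    (fun i : Fin m => (⟨x i, i, rfl⟩ : (F.induce (Set.range x)).verts)) ⟨fun i j e => ?_, ?_⟩,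
    fun {i j} => ?_⟩⟩⟩
  · have := (h.eq_iff i j).1 (Subtype.ext_iff.1 e)
    rw [Nat.mod_eq_of_lt i.isLt, Nat.mod_eq_of_lt j.isLt] at this
    exact Fin.ext this
  · rintro ⟨_, i, rfl⟩
    exact ⟨⟨i % m, Nat.mod_lt _ (by omega)⟩, Subtype.ext (h.mod_apply i)⟩
  · have e : (F.induce (Set.range x)).coe.Adj ⟨x i, i, rfl⟩ ⟨x j, j, rfl⟩ ↔
        F.spanningCoe.Adj (x i) (x j) := by
      simp [SimpleGraph.Subgraph.induce_adj]
    rw [cycleGraph_adj_iff h3]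
    refine e.trans ⟨fun hadj => ?_, fun hadj => ?_⟩
    · obtain hj | hj := h.eq_or_eq_of_adj hF hadj
      · left
        rw [h.eq_iff, Nat.mod_eq_of_lt j.isLt] at hj
        exact hj.symm
      · right
        have e : x (j + 1) = x i := by
          rw [← h.add_period i, h.eq_iff, show i.val + m = i + (m - 1) + 1 by omega]
          exact Nat.ModEq.add_right 1 ((h.eq_iff _ _).1 hj)
        rwa [h.eq_iff, Nat.mod_eq_of_lt i.isLt] at e
    · obtain hj | hj := hadj
      · rw [← hj, h.mod_apply]
        exact h.adj _
      · rw [← hj, h.mod_apply]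
        exact (h.adj _).symm

/-! ### From periodic colourings to colourings of 2-regular graphs. -/

/-- A coloring with colours `0, 1, 2, 3`, seen from the vertex `v`: neighbours of `v` have another
colour, and so have the vertices at distance two if the colour of `v` is special. -/
structure IsGoodAt (H : SimpleGraph V) (f : V → ℕ) (v : V) : Prop where
  lt : f v < 4
  ne : ∀ w, H.Adj v w → f v ≠ f w
  special : ∀ w z, H.Adj v w → H.Adj w z → v ≠ z → 2 ≤ f v → f v ≠ f z

theorem IsGoodAt.congr {H : SimpleGraph V} {f g : V → ℕ} {v : V} (h : IsGoodAt H f v)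
    (hfg : ∀ w, H.Reachable v w → g w = f w) : IsGoodAt H g v where
  lt := by rw [hfg v (SimpleGraph.Reachable.refl v)]; exact h.lt
  ne w hw := by
    rw [hfg v (SimpleGraph.Reachable.refl v), hfg w hw.reachable]
    exact h.ne w hw
  special w z hw hz hne := by
    rw [hfg v (SimpleGraph.Reachable.refl v), hfg z (hw.reachable.trans hz.reachable)]
    exact h.special w z hw hz hne

/-- Being good at `v` depends only on the component of `v`, so colourings of the components can be
chosen independently and glued. -/
theorem exists_isGoodAt_of_components {H : SimpleGraph V} {ok : V → ℕ → Prop}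
    (h : ∀ a, ∃ f : V → ℕ, ∀ v, H.Reachable a v → IsGoodAt H f v ∧ ok v (f v)) :
    ∃ f : V → ℕ, ∀ v, IsGoodAt H f v ∧ ok v (f v) := by
  have h' (K : H.ConnectedComponent) :
      ∃ f : V → ℕ, ∀ v, H.connectedComponentMk v = K → IsGoodAt H f v ∧ ok v (f v) := by
    induction K using SimpleGraph.ConnectedComponent.ind with
    | h a =>
      obtain ⟨f, hf⟩ := h a
      exact ⟨f, fun v hv => hf v (SimpleGraph.ConnectedComponent.exact hv.symm)⟩
  choose f hf using h'
  refine ⟨fun v => f (H.connectedComponentMk v) v, fun v => ⟨(hf _ v rfl).1.congr fun w hw => ?_,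
    (hf _ v rfl).2⟩⟩
  rw [SimpleGraph.ConnectedComponent.sound hw]

theorem IsCyclicColoring.mod_apply {m : ℕ} {c : ℕ → ℕ} (h : IsCyclicColoring m c) (i : ℕ) :
    c (i % m) = c i :=
  Function.Periodic.map_mod_nat (f := c) h.periodic i

theorem IsCycleParam.exists_isGoodAt [Finite V] {H : SimpleGraph V} {m : ℕ} {x : ℕ → V}
    (hx : IsCycleParam H m x) (hH : ∀ v, (H.neighborSet v).ncard = 2) {c : ℕ → ℕ}
    (hc : IsCyclicColoring m c) :
    ∃ f : V → ℕ, (∀ i, f (x i) = c i) ∧ ∀ i, IsGoodAt H f (x i) := by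
  classical
  have h3 := hx.three_le
  let f : V → ℕ := fun v => if h : ∃ i, x i = v then c h.choose else 0
  have hf (i : ℕ) : f (x i) = c i := by
    have h : ∃ j, x j = x i := ⟨i, rfl⟩
    have e : f (x i) = c h.choose := dif_pos h
    rw [e, ← hc.mod_apply h.choose, ← hc.mod_apply i, (hx.eq_iff _ _).1 h.choose_spec]
  have hpred (i : ℕ) : x (i + (m - 1) + 1) = x i := by
    rw [show i + (m - 1) + 1 = i + m by omega, hx.add_period]
  refine ⟨f, hf, fun i => ⟨?_, fun w hw => ?_, fun w z hw hz hne hs => ?_⟩⟩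
  · rw [hf]; exact hc.lt i
  · obtain rfl | rfl := hx.eq_or_eq_of_adj hH hw
    · rw [hf, hf]; exact hc.ne i
    · have := hc.ne (i + (m - 1))
      rw [← hf, ← hf (_ + 1), hpred] at this
      exact this.symm
  · obtain rfl | rfl := hx.eq_or_eq_of_adj hH hw
    · obtain rfl | rfl := hx.eq_or_eq_of_adj hH hz
      · rw [hf] at hs
        rw [hf, hf]
        exact hc.special i hs
      · exact absurd (by rw [show i + 1 + (m - 1) = i + m by omega, hx.add_period]) hne
    · obtain rfl | rfl := hx.eq_or_eq_of_adj hH hz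
      · exact absurd (hpred i).symm hne
      · intro e
        -- `special` looks forward only, so it is applied at `z`, two steps behind; the assumed
        -- equality makes the colour of `z` special too.
        have := hc.special (i + (m - 1) + (m - 1))
        rw [← hf, ← hf (_ + 2), show i + (m - 1) + (m - 1) + 2 = i + m + m by omega, hx.add_period,
          hx.add_period] at this
        exact this (e ▸ hs) e.symm

/-- The map `5 - c` exchanges 2 and 3. It serves to free one prescribed vertex from colour 2. -/
theorem IsCyclicColoring.swap {m : ℕ} {c : ℕ → ℕ} (h : IsCyclicColoring m c) :
    IsCyclicColoring m fun i => if 2 ≤ c i then 5 - c i else c i where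
  lt i := by have := h.lt i; split_ifs <;> omega
  periodic i := by simp only [h.periodic]
  ne i := by
    have := h.ne i; have := h.lt i; have := h.lt (i + 1)
    split_ifs <;> omega
  special i hi := by
    have := h.special i; have := h.lt i; have := h.lt (i + 2)
    split_ifs at hi ⊢ <;> omega

/-- On a cycle of length different from `5`, a coloring in which one vertex keeps its label and a
second one avoids the colour `2`. -/
theorem exists_isGoodAt_of_label [Finite V] {H : SimpleGraph V}
    (hH : ∀ v, (H.neighborSet v).ncard = 2) (lab : V → ℕ) (hlab : ∀ v, lab v < 2) (a q : V)
    (ha : ∀ x, IsCycleParam H 5 x → x 0 ≠ a) :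
    ∃ f : V → ℕ, ∀ v, H.Reachable a v →
      IsGoodAt H f v ∧ (f v = lab v ∨ 2 ≤ f v) ∧ (v = a → f v = lab v) ∧ (v = q → f v ≠ 2) := by
  obtain ⟨m, x, hx, rfl⟩ := exists_isCycleParam hH a
  have hm5 : m ≠ 5 := by rintro rfl; exact ha x hx rfl
  obtain ⟨c, hc, h0, hl⟩ := exists_cyclicColoring hx.three_le hm5 (fun i => lab (x i))
    fun i => hlab _
  have hl' (i : ℕ) : c i = lab (x i) ∨ 2 ≤ c i := by
    have := hl (i % m) (Nat.mod_lt _ (by have := hx.three_le; omega))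
    rwa [hc.mod_apply, hx.mod_apply] at this
  obtain ⟨c', hc', h0', hl', hq'⟩ : ∃ c', IsCyclicColoring m c' ∧ c' 0 = lab (x 0) ∧
      (∀ i, c' i = lab (x i) ∨ 2 ≤ c' i) ∧ ∀ i, x i = q → c' i ≠ 2 := by
    by_cases hq : ∃ i, x i = q ∧ c i = 2
    · obtain ⟨i, rfl, hi⟩ := hq
      refine ⟨_, hc.swap, ?_, fun j => ?_, fun j hj => ?_⟩
      · have := hlab (x 0)
        rw [if_neg (by omega), h0]
      · have := hl' j
        have := hc.lt j
        have := hlab (x j)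
        split_ifs <;> omega
      · have : c j = 2 := by
          rw [← hc.mod_apply, (hx.eq_iff _ _).1 hj, hc.mod_apply, hi]
        simp [this]
    · push Not at hq
      exact ⟨c, hc, h0, hl', hq⟩
  obtain ⟨f, hf, hgood⟩ := hx.exists_isGoodAt hH hc'
  refine ⟨f, fun v hv => ?_⟩
  obtain ⟨i, rfl⟩ := hx.mem_range_of_reachable hH hv
  refine ⟨hgood i, ?_, fun h => ?_, fun h => ?_⟩
  · rw [hf]; exact hl' i
  · rw [h, hf, h0']
  · rw [hf]; exact hq' i h

/-- A coloring of a cycle for use next to a vertex of colour `2` whose neighbour is `x 0`. -/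
theorem IsCycleParam.exists_isGoodAt_of_marked [Finite V] {H : SimpleGraph V} {m : ℕ} {x : ℕ → V}
    (hx : IsCycleParam H m x) (hH : ∀ v, (H.neighborSet v).ncard = 2)
    (lab : V → ℕ) (hlab : ∀ v, lab v < 2) {p q : ℕ} (hp0 : 1 ≤ p) (hq0 : 1 ≤ q)
    (hp : p < m → lab (x p) = 1) (hq : q < m → lab (x q) = 0) (hm5 : m = 5 → m ≤ p ∨ m ≤ q) :
    ∃ f : V → ℕ, ∀ v, H.Reachable (x 0) v →
      IsGoodAt H f v ∧ (v = x 0 → f v < 2) ∧ (v ≠ x 0 → f v = lab v ∨ 2 ≤ f v) ∧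
      (H.Adj (x 0) v → f v ≠ 2) ∧ (p < m → f (x p) ≠ 2) ∧ (q < m → f (x q) ≠ 2) := by
  have h3 := hx.three_le
  obtain ⟨c, hc, h0, h1, h2, hcp, hcq, hl⟩ := exists_marked_cyclicColoring h3
    (fun i => lab (x i)) (fun i => hlab _) hp0 hq0 hp hq hm5
  obtain ⟨f, hf, hgood⟩ := hx.exists_isGoodAt hH hc
  refine ⟨f, fun v hv => ?_⟩
  obtain ⟨i, rfl⟩ := hx.mem_range_of_reachable hH hv
  refine ⟨hgood i, fun h => ?_, fun h => ?_, fun h => ?_, ?_, ?_⟩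
  · rw [h, hf]; exact h0
  · rw [Ne, hx.eq_iff, Nat.zero_mod] at h
    have := hl (i % m) (by omega) (Nat.mod_lt _ (by omega))
    rwa [hc.mod_apply, hx.mod_apply, ← hf] at this
  · obtain h | h := hx.eq_or_eq_of_adj hH h
    · rw [h, hf]; exact h1
    · rw [h, hf, Nat.zero_add]; exact h2
  · rw [hf]; exact hcp
  · rw [hf]; exact hcq

/-! ### From colour functions to packings, and the subdivision. -/

theorem isSColorable_of_coloring {G : SimpleGraph V} (f : V → ℕ) (hf : ∀ v, f v < 4)
    (h1 : ∀ v w, G.Adj v w → f v ≠ f w)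
    (h2 : ∀ v z w, G.Adj v z → G.Adj z w → v ≠ w → 2 ≤ f v → f v ≠ f w) :
    IsSColorable G ![1, 1, 2, 2] := by
  refine ⟨fun v => ⟨f v, hf v⟩, fun j u hu v hv huv => ?_⟩
  have hfu : f u = j := by simpa [Fin.ext_iff] using hu
  have hfv : f v = j := by simpa [Fin.ext_iff] using hv
  have hadj : ¬ G.Adj u v := fun h => h1 u v h (hfu.trans hfv.symm)
  have hone : (1 : ℕ∞) < G.edist u v := by
    rw [← not_le, SimpleGraph.edist_le_one_iff_adj_or_eq]
    tauto
  have htwo (hj : 2 ≤ (j : ℕ)) : (2 : ℕ∞) < G.edist u v := by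
    rw [SimpleGraph.two_lt_edist_iff]
    refine ⟨huv, hadj, Set.eq_empty_of_forall_notMem fun z hz => ?_⟩
    rw [SimpleGraph.mem_commonNeighbors] at hz
    exact h2 u z v hz.1 hz.2.symm huv (hfu ▸ hj) (hfu.trans hfv.symm)
  fin_cases j
  · simpa using hone
  · simpa using hone
  · simpa using htwo le_rfl
  · simpa using htwo (by simp)

/-- Two steps of the walk pass through one edge vertex and either return to the same end, which can
be dropped, or traverse that edge of `G`. -/
theorem exists_walk_of_subdivision_walk (G : SimpleGraph V) (k : ℕ) :
    ∀ u v : V, ∀ p : (subdivision G).Walk (Sum.inl u) (Sum.inl v), p.length ≤ k →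
      ∃ q : G.Walk u v, 2 * q.length ≤ p.length := by
  induction k using Nat.strong_induction_on with
  | _ k ih =>
    intro u v p hp
    cases p with
    | nil => exact ⟨SimpleGraph.Walk.nil, by simp⟩
    | @cons _ b _ h p =>
      obtain b | ⟨e, he⟩ := b
      · exact h.elim
      · cases p with
        | @cons _ c _ h' p =>
          obtain w | _ := c
          · simp only [SimpleGraph.Walk.length_cons] at hp ⊢
            obtain ⟨q, hq⟩ := ih p.length (by omega) w v p le_rfl
            by_cases huw : u = w
            · subst huw
              exact ⟨q, by omega⟩
            · have hu : u ∈ e := h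
              have hw : w ∈ e := h'
              have : e = s(u, w) := (Sym2.mem_and_mem_iff huw).1 ⟨hu, hw⟩
              have hadj : G.Adj u w := by rwa [this, SimpleGraph.mem_edgeSet] at he
              exact ⟨SimpleGraph.Walk.cons hadj q, by simp only [SimpleGraph.Walk.length_cons]; omega⟩
          · exact h'.elim

theorem lt_edist_subdivision {G : SimpleGraph V} {i : ℕ} {u v : V} (h : (i : ℕ∞) < G.edist u v) :
    ((2 * i + 1 : ℕ) : ℕ∞) < (subdivision G).edist (Sum.inl u) (Sum.inl v) := by
  by_contra! hle
  obtain ⟨p, hp⟩ := SimpleGraph.exists_walk_of_edist_ne_top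
    (ne_top_of_le_ne_top (ENat.natCast_ne_top _) hle)
  rw [← hp, Nat.cast_le] at hle
  obtain ⟨q, hq⟩ := exists_walk_of_subdivision_walk G _ u v p le_rfl
  have := h.trans_le q.edist_le
  rw [Nat.cast_lt] at this
  omega

/-- A `(1, 1, 2, 2)`-coloring yields a packing coloring of the subdivision with five colours. -/
theorem IsSColorable.packingChromaticNumber_subdivision_le {G : SimpleGraph V}
    (h : IsSColorable G ![1, 1, 2, 2]) : packingChromaticNumber (subdivision G) ≤ 5 := by
  obtain ⟨c, hc⟩ := h
  suffices IsPackingColorable (subdivision G) 5 from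
    iInf₂_le (f := fun k (_ : k ∈ {k : ℕ | IsPackingColorable (subdivision G) k}) => (k : ℕ∞)) 5 this
  -- The independent edge vertices form the 1-packing. On the old vertices distance greater than `i`
  -- becomes greater than `2 * i + 1`, so the classes for 1, 1, 2, 2 serve as packings for 2, 3, 4,
  -- 5.
  refine ⟨Sum.elim (fun v => (c v).succ) fun _ => 0, fun j => ?_⟩
  rintro (u | e) hu (v | f) hv huv
  · simp only [Set.mem_preimage, Sum.elim_inl, Set.mem_singleton_iff] at hu hv
    subst hu
    have := lt_edist_subdivision (hc (c u) u rfl v (Fin.succ_injective _ hv)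
      fun h => huv (congrArg _ h))
    refine lt_of_le_of_lt ?_ this
    generalize c u = k
    rw [Nat.cast_le]
    fin_cases k <;> simp
  · simp only [Set.mem_preimage, Sum.elim_inl, Sum.elim_inr, Set.mem_singleton_iff] at hu hv
    exact absurd (hu.trans hv.symm) (Fin.succ_ne_zero _)
  · simp only [Set.mem_preimage, Sum.elim_inl, Sum.elim_inr, Set.mem_singleton_iff] at hu hv
    exact absurd (hv.trans hu.symm) (Fin.succ_ne_zero _)
  · simp only [Set.mem_preimage, Sum.elim_inr, Set.mem_singleton_iff] at hu
    subst hu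
    have : ¬ (subdivision G).edist (Sum.inr e) (Sum.inr f) ≤ 1 := by
      rw [SimpleGraph.edist_le_one_iff_adj_or_eq]
      rintro (h | h)
      exacts [h, huv h]
    simpa using this

/-! ### Gluing colourings along the matching. -/

/-- `G` consists of the cycles of `H` and the matching `v ↦ μ v`, and every edge of this matching
joins the cycle of `H` parametrized by `u` to another vertex. -/
structure IsMatchedCycle (G H : SimpleGraph V) (μ : V → V) (n : ℕ) (u : ℕ → V) : Prop where
  two : ∀ v, (H.neighborSet v).ncard = 2
  param : IsCycleParam H n u
  invol : ∀ v, μ (μ v) = v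
  mem_range : ∀ v, μ v ∈ Set.range u ↔ v ∉ Set.range u
  adj : ∀ v w, G.Adj v w → H.Adj v w ∨ w = μ v

namespace IsMatchedCycle

variable {G H : SimpleGraph V} {μ : V → V} {n : ℕ} {u : ℕ → V}

theorem shift (h : IsMatchedCycle G H μ n u) (s : ℕ) :
    IsMatchedCycle G H μ n fun i => u (i + s) where
  two := h.two
  param := h.param.shift s
  invol := h.invol
  mem_range := by
    have : (Set.range fun i => u (i + s)) = Set.range u := by
      refine Set.Subset.antisymm (Set.range_subset_iff.2 fun i => ⟨i + s, rfl⟩)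
        (Set.range_subset_iff.2 fun i => ⟨i + (n - 1) * s, ?_⟩)
      obtain ⟨k, hk⟩ := Nat.exists_eq_add_of_le' h.param.three_le
      dsimp only
      rw [h.param.eq_iff]
      have : i + (n - 1) * s + s = i + n * s := by
        subst hk
        rw [show k + 3 - 1 = k + 2 by omega]
        ring
      rw [this, Nat.add_mul_mod_self_left]
    rw [this]
    exact h.mem_range
  adj := h.adj

theorem mem_range_of_adj [Finite V] (h : IsMatchedCycle G H μ n u) {v w : V}
    (hv : v ∈ Set.range u) (hvw : H.Adj v w) : w ∈ Set.range u := by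
  obtain ⟨i, rfl⟩ := hv
  obtain rfl | rfl := h.param.eq_or_eq_of_adj h.two hvw
  exacts [⟨_, rfl⟩, ⟨_, rfl⟩]

theorem mem_range_iff_of_reachable [Finite V] (h : IsMatchedCycle G H μ n u) {v w : V}
    (hvw : H.Reachable v w) : v ∈ Set.range u ↔ w ∈ Set.range u := by
  suffices ∀ (a b : V) (_ : H.Walk a b), a ∈ Set.range u → b ∈ Set.range u from
    ⟨this _ _ hvw.some, this _ _ hvw.symm.some⟩
  intro a b p
  induction p with
  | nil => exact id
  | cons hadj _ ih => exact fun ha => ih (h.mem_range_of_adj ha hadj)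

/-- A path of length two between distinct vertices has at most one matching edge. If it has one,
exactly one of its ends lies on the main cycle, and `h1`, `h2` treat the two places of the matching
edge as seen from that end. -/
theorem isSColorable [Finite V] (h : IsMatchedCycle G H μ n u) (f : V → ℕ)
    (hf : ∀ v, IsGoodAt H f v) (hμ : ∀ i, f (u i) ≠ f (μ (u i)))
    (h1 : ∀ i w, 2 ≤ f (u i) → H.Adj (μ (u i)) w → f (u i) ≠ f w)
    (h2 : ∀ i j, 2 ≤ f (u i) → H.Adj (u i) (u j) → f (u i) ≠ f (μ (u j))) :
    IsSColorable G ![1, 1, 2, 2] := by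
  have hcross (v w : V) (hv : 2 ≤ f v) (hvw : H.Adj (μ v) w) : f v ≠ f w := by
    by_cases hS : v ∈ Set.range u
    · obtain ⟨i, rfl⟩ := hS
      exact h1 i w hv hvw
    · obtain ⟨j, hj⟩ := (h.mem_range v).2 hS
      obtain ⟨i, rfl⟩ := h.mem_range_of_adj ⟨j, hj⟩ hvw
      intro e
      have := h2 i j (e ▸ hv) (hj ▸ hvw.symm)
      rw [hj, h.invol] at this
      exact this e.symm
  refine isSColorable_of_coloring f (fun v => (hf v).lt) (fun v w hvw => ?_)
    fun v z w hvz hzw hne hs => ?_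
  · obtain hvw | rfl := h.adj v w hvw
    · exact (hf v).ne w hvw
    · by_cases hS : v ∈ Set.range u
      · obtain ⟨i, rfl⟩ := hS
        exact hμ i
      · obtain ⟨i, hi⟩ := (h.mem_range v).2 hS
        have := hμ i
        rw [hi, h.invol] at this
        exact this.symm
  · obtain hvz | rfl := h.adj v z hvz
    · obtain hzw | rfl := h.adj z w hzw
      · exact (hf v).special z w hvz hzw hne hs
      · intro e
        exact hcross (μ z) v (e ▸ hs) (by rw [h.invol]; exact hvz.symm) e.symm
    · obtain hzw | rfl := h.adj _ w hzw
      · exact hcross v w hs hzw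
      · exact absurd (h.invol v).symm hne

/-- The case of an even cycle, which is colored without special colours. -/
theorem isSColorable_of_even [Finite V] (h : IsMatchedCycle G H μ n u) (hn : Even n)
    (h5 : ∀ x, IsCycleParam H 5 x → x 0 ∈ Set.range u) : IsSColorable G ![1, 1, 2, 2] := by
  have hper (i : ℕ) : (i + n) % 2 = i % 2 := by
    obtain ⟨k, rfl⟩ := hn
    omega
  have hc : IsCyclicColoring n fun i => i % 2 :=
    ⟨fun i => by omega, hper, fun i => by omega, fun i => by omega⟩
  obtain ⟨κ, hκ, hgood⟩ := h.param.exists_isGoodAt h.two hc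
  obtain ⟨f, hf⟩ := exists_isGoodAt_of_components (H := H)
    (ok := fun v c => (v ∈ Set.range u → c = κ v) ∧
      (v ∉ Set.range u → c = 1 - κ (μ v) ∨ 2 ≤ c)) fun a => by
    by_cases ha : a ∈ Set.range u
    · refine ⟨κ, fun v hv => ?_⟩
      have hv := (h.mem_range_iff_of_reachable hv).1 ha
      refine ⟨?_, fun _ => rfl, fun h => absurd hv h⟩
      obtain ⟨i, rfl⟩ := hv
      exact hgood i
    · obtain ⟨f, hf⟩ := exists_isGoodAt_of_label h.two (fun v => 1 - κ (μ v)) (fun v => by omega)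
        a a fun x hx h0 => ha (h0 ▸ h5 x hx)
      refine ⟨f, fun v hv => ⟨(hf v hv).1, fun hvS => ?_, fun _ => (hf v hv).2.1⟩⟩
      exact absurd ((h.mem_range_iff_of_reachable hv).2 hvS) ha
  have hfu (i : ℕ) : f (u i) = i % 2 := ((hf _).2.1 ⟨i, rfl⟩).trans (hκ i)
  refine h.isSColorable f (fun v => (hf v).1) (fun i => ?_) (fun i w hi => ?_) fun i j hi => ?_
  · have := (hf (μ (u i))).2.2 fun hS => (h.mem_range _).1 hS ⟨i, rfl⟩
    rw [h.invol, hκ] at this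
    rw [hfu]
    omega
  · rw [hfu] at hi; omega
  · rw [hfu] at hi; omega

end IsMatchedCycle

theorem IsCycleParam.exists_index [Finite V] {H : SimpleGraph V} {m : ℕ} {x : ℕ → V}
    (hx : IsCycleParam H m x) (hH : ∀ v, (H.neighborSet v).ncard = 2) {r : V}
    (hr : H.Reachable (x 0) r) (hne : r ≠ x 0) : ∃ i, 1 ≤ i ∧ i < m ∧ x i = r := by
  obtain ⟨i, rfl⟩ := hx.mem_range_of_reachable hH hr
  rw [Ne, hx.eq_iff, Nat.zero_mod] at hne
  exact ⟨i % m, by omega, Nat.mod_lt _ (by have := hx.three_le; omega), hx.mod_apply i⟩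

/-- The coloring of a cycle in which one vertex gets the colour `2` and the others alternate. -/
theorem isCyclicColoring_alternating {n : ℕ} (hn : 3 ≤ n) :
    IsCyclicColoring n fun i => if i % n = 0 then 2 else (i % n + 1) % 2 where
  lt i := by split_ifs <;> omega
  periodic i := by simp
  ne i := by
    have h := succ_mod_cases (show 0 < n by omega) i
    generalize i % n = r, (i + 1) % n = s at *
    split_ifs <;> omega
  special i hi := by
    have h := succ_mod_cases (show 0 < n by omega) i
    have h' := succ_mod_cases (show 0 < n by omega) (i + 1)
    rw [show i + 1 + 1 = i + 2 by omega] at h'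
    generalize i % n = r, (i + 1) % n = s, (i + 2) % n = t at *
    split_ifs at hi ⊢ <;> omega

namespace IsMatchedCycle

variable {G H : SimpleGraph V} {μ : V → V} {n : ℕ} {u : ℕ → V}

theorem injective (h : IsMatchedCycle G H μ n u) : Function.Injective μ :=
  Function.LeftInverse.injective h.invol

/-- The case in which one vertex of the cycle gets the colour `2`. -/
theorem isSColorable_of_special [Finite V] (h : IsMatchedCycle G H μ n u)
    (h5 : ∀ x, IsCycleParam H 5 x → x 0 ∉ Set.range u → H.Reachable (μ (u 0)) (x 0))
    (hp : H.Reachable (μ (u 0)) (μ (u 1)) → Odd n ∧ ∀ x, IsCycleParam H 5 x → x 0 ≠ μ (u 0)) :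
    IsSColorable G ![1, 1, 2, 2] := by
  have h3 := h.param.three_le
  obtain ⟨κ, hκ, hgood⟩ := h.param.exists_isGoodAt h.two (isCyclicColoring_alternating h3)
  have hκ1 : κ (u 1) = 0 := by
    rw [hκ, Nat.mod_eq_of_lt (by omega)]
    rfl
  have hκ2 : κ (u (n - 1)) = n % 2 := by
    rw [hκ, Nat.mod_eq_of_lt (by omega), if_neg (by omega)]
    congr 1
    omega
  have hne (i : ℕ) (hi : i % n ≠ 0) : μ (u i) ≠ μ (u 0) := fun e => hi (by
    have := (h.param.eq_iff _ _).1 (h.injective e)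
    rwa [Nat.zero_mod] at this)
  have hne1 : μ (u 1) ≠ μ (u 0) := hne 1 (by rw [Nat.mod_eq_of_lt (by omega)]; omega)
  have hne2 : μ (u (n - 1)) ≠ μ (u 0) := hne (n - 1) (by rw [Nat.mod_eq_of_lt (by omega)]; omega)
  -- At `μ (u 0)` the truncated subtraction `1 - 2` gives a meaningless label; that vertex is free
  -- to take 0 or 1 anyway.
  let lab : V → ℕ := fun v => 1 - κ (μ v)
  have hlab (v : V) : lab v < 2 := by simp only [lab]; omega
  have hlab1 : lab (μ (u 1)) = 1 := by simp only [lab]; rw [h.invol, hκ1]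
  have hlab2 : lab (μ (u (n - 1))) = 1 - n % 2 := by simp only [lab]; rw [h.invol, hκ2]
  obtain ⟨f₀, hf₀⟩ : ∃ f : V → ℕ, ∀ v, H.Reachable (μ (u 0)) v → IsGoodAt H f v ∧
      (v = μ (u 0) → f v < 2) ∧ (v ≠ μ (u 0) → f v = lab v ∨ 2 ≤ f v) ∧
      (H.Adj (μ (u 0)) v → f v ≠ 2) ∧ (v = μ (u 1) → f v ≠ 2) ∧ (v = μ (u (n - 1)) → f v ≠ 2) := by
    obtain ⟨m, x, hx, hx0⟩ := exists_isCycleParam h.two (μ (u 0))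
    rw [← hx0] at hne1 hne2 hp ⊢
    -- `P` and `Q` are slots for marked positions with labels 1 and 0; the value `m` encodes an
    -- empty slot. For even `n` both mates have label 1, but then `hp` keeps `μ (u 1)` off this
    -- cycle and one slot suffices.
    obtain ⟨P, Q, hP, hQ, hPl, hQl, hm5, hr1, hr2⟩ : ∃ P Q, 1 ≤ P ∧ 1 ≤ Q ∧
        (P < m → lab (x P) = 1) ∧ (Q < m → lab (x Q) = 0) ∧ (m = 5 → m ≤ P ∨ m ≤ Q) ∧
        (H.Reachable (x 0) (μ (u 1)) → P < m ∧ x P = μ (u 1) ∨ Q < m ∧ x Q = μ (u 1)) ∧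
        (H.Reachable (x 0) (μ (u (n - 1))) →
          P < m ∧ x P = μ (u (n - 1)) ∨ Q < m ∧ x Q = μ (u (n - 1))) := by
      have hm := hx.three_le
      by_cases h1 : H.Reachable (x 0) (μ (u 1))
      · obtain ⟨⟨k, hk⟩, hno5⟩ := hp h1
        have hm5 : m ≠ 5 := by rintro rfl; exact hno5 x hx rfl
        obtain ⟨P, hP, hPm, hxP⟩ := hx.exists_index h.two h1 hne1
        by_cases h2 : H.Reachable (x 0) (μ (u (n - 1)))
        · obtain ⟨Q, hQ, hQm, hxQ⟩ := hx.exists_index h.two h2 hne2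
          exact ⟨P, Q, hP, hQ, fun _ => by rw [hxP, hlab1], fun _ => by rw [hxQ, hlab2]; omega,
            fun e => absurd e hm5, fun _ => Or.inl ⟨hPm, hxP⟩, fun _ => Or.inr ⟨hQm, hxQ⟩⟩
        · exact ⟨P, m, hP, by omega, fun _ => by rw [hxP, hlab1], fun e => by omega,
            fun e => absurd e hm5, fun _ => Or.inl ⟨hPm, hxP⟩, fun e => absurd e h2⟩
      · by_cases h2 : H.Reachable (x 0) (μ (u (n - 1)))
        · obtain ⟨Q, hQ, hQm, hxQ⟩ := hx.exists_index h.two h2 hne2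
          obtain hpar | hpar := Nat.mod_two_eq_zero_or_one n
          · exact ⟨Q, m, hQ, by omega, fun _ => by rw [hxQ, hlab2]; omega, fun e => by omega,
              fun _ => Or.inr le_rfl, fun e => absurd e h1, fun _ => Or.inl ⟨hQm, hxQ⟩⟩
          · exact ⟨m, Q, by omega, hQ, fun e => by omega, fun _ => by rw [hxQ, hlab2]; omega,
              fun _ => Or.inl le_rfl, fun e => absurd e h1, fun _ => Or.inr ⟨hQm, hxQ⟩⟩
        · exact ⟨m, m, by omega, by omega, fun e => by omega, fun e => by omega,
            fun _ => Or.inl le_rfl, fun e => absurd e h1, fun e => absurd e h2⟩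
    obtain ⟨f, hf⟩ := hx.exists_isGoodAt_of_marked h.two lab hlab hP hQ hPl hQl hm5
    refine ⟨f, fun v hv => ?_⟩
    obtain ⟨g1, g2, g3, g4, g5, g6⟩ := hf v hv
    refine ⟨g1, g2, g3, g4, ?_, ?_⟩
    · rintro rfl
      obtain ⟨hm, e⟩ | ⟨hm, e⟩ := hr1 hv
      exacts [e ▸ g5 hm, e ▸ g6 hm]
    · rintro rfl
      obtain ⟨hm, e⟩ | ⟨hm, e⟩ := hr2 hv
      exacts [e ▸ g5 hm, e ▸ g6 hm]
  have hd : μ (u 0) ∉ Set.range u := fun hS => (h.mem_range _).1 hS ⟨0, rfl⟩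
  obtain ⟨f, hf⟩ := exists_isGoodAt_of_components (H := H)
    (ok := fun v c => (v ∈ Set.range u → c = κ v) ∧ (v ∉ Set.range u →
      (v = μ (u 0) → c < 2) ∧ (v ≠ μ (u 0) → c = lab v ∨ 2 ≤ c) ∧
      (H.Adj (μ (u 0)) v → c ≠ 2) ∧ (v = μ (u 1) → c ≠ 2) ∧ (v = μ (u (n - 1)) → c ≠ 2))) fun a => by
    by_cases ha : a ∈ Set.range u
    · refine ⟨κ, fun v hv => ?_⟩
      have hv := (h.mem_range_iff_of_reachable hv).1 ha
      refine ⟨?_, fun _ => rfl, fun h => absurd hv h⟩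
      obtain ⟨i, rfl⟩ := hv
      exact hgood i
    · by_cases had : H.Reachable a (μ (u 0))
      · refine ⟨f₀, fun v hv => ?_⟩
        have hv' := hf₀ v (had.symm.trans hv)
        exact ⟨hv'.1, fun hvS => absurd ((h.mem_range_iff_of_reachable hv).2 hvS) ha, fun _ => hv'.2⟩
      -- The start of the cycle keeps its label, so starting at `μ (u 1)`, if it is on this cycle,
      -- makes it avoid 2; the swap takes care of `μ (u (n - 1))`.
      · obtain ⟨b, hab, hb⟩ : ∃ b, H.Reachable a b ∧
            (H.Reachable a (μ (u 1)) → b = μ (u 1)) := by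
          by_cases h1 : H.Reachable a (μ (u 1))
          exacts [⟨_, h1, fun _ => rfl⟩, ⟨a, SimpleGraph.Reachable.refl a, fun e => absurd e h1⟩]
        obtain ⟨f, hf⟩ := exists_isGoodAt_of_label h.two lab hlab b (μ (u (n - 1)))
          fun x hx hxb => had <| by
            rw [← hxb] at hab
            exact hab.trans (h5 x hx fun hS =>
              ha ((h.mem_range_iff_of_reachable hab).2 hS)).symm
        refine ⟨f, fun v hv => ?_⟩
        obtain ⟨g1, g2, g3, g4⟩ := hf v (hab.symm.trans hv)
        refine ⟨g1, fun hvS => absurd ((h.mem_range_iff_of_reachable hv).2 hvS) ha, fun _ =>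
          ⟨fun e => absurd (e ▸ hv) had, fun _ => g2, fun e => absurd (hv.trans e.symm.reachable) had,
            fun e => ?_, g4⟩⟩
        have := g3 (e.trans (hb (e ▸ hv)).symm)
        have := hlab v
        omega
  have hfu (i : ℕ) : f (u i) = if i % n = 0 then 2 else (i % n + 1) % 2 :=
    ((hf _).2.1 ⟨i, rfl⟩).trans (hκ i)
  have hzero {i : ℕ} (hi : 2 ≤ f (u i)) : u i = u 0 ∧ f (u i) = 2 := by
    rw [hfu, h.param.eq_iff, Nat.zero_mod] at *
    split_ifs at hi ⊢ with h0
    · exact ⟨h0, rfl⟩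
    · omega
  have hμ (i : ℕ) : μ (u i) ∉ Set.range u := fun hS => (h.mem_range _).1 hS ⟨i, rfl⟩
  refine h.isSColorable f (fun v => (hf v).1) (fun i => ?_) (fun i w hi hw => ?_) fun i j hi hij => ?_
  · obtain ⟨g1, g2, -⟩ := (hf (μ (u i))).2.2 (hμ i)
    by_cases hi : i % n = 0
    · have e : u i = u 0 := (h.param.eq_iff _ _).2 (by rw [hi, Nat.zero_mod])
      have := g1 (by rw [e])
      rw [hfu, if_pos hi]
      omega
    · have := g2 (hne i hi)
      have e : lab (μ (u i)) = 1 - (i % n + 1) % 2 := by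
        simp only [lab]
        rw [h.invol, hκ, if_neg hi]
      rw [hfu, if_neg hi]
      omega
  · obtain ⟨e, e2⟩ := hzero hi
    rw [e] at hw
    have hwS : w ∉ Set.range u := fun hS => hμ 0 ((h.mem_range_iff_of_reachable hw.reachable).2 hS)
    rw [e2]
    exact (((hf w).2.2 hwS).2.2.1 hw).symm
  · obtain ⟨e, e2⟩ := hzero hi
    rw [e] at hij
    obtain ⟨-, -, -, g1, g2⟩ := (hf (μ (u j))).2.2 (hμ j)
    rw [e2]
    obtain e | e := h.param.eq_or_eq_of_adj h.two hij
    · exact (g1 (by rw [e])).symm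
    · exact (g2 (by rw [e, Nat.zero_add])).symm

/-- A 5-cycle off the main cycle allows a choice of the vertex of colour `2`. -/
theorem isSColorable_of_five_cycle [Finite V] (h : IsMatchedCycle G H μ n u) {x : ℕ → V}
    (hx : IsCycleParam H 5 x) (hxu : x 0 ∉ Set.range u) (hn : n ≠ 5)
    (hcard : (Set.range u)ᶜ.ncard = n)
    (h5 : ∀ y, IsCycleParam H 5 y → y 0 ∉ Set.range u → Set.range y = Set.range x) :
    IsSColorable G ![1, 1, 2, 2] := by
  have hxS : Set.range x ⊆ (Set.range u)ᶜ := by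
    rintro _ ⟨i, rfl⟩ hS
    exact hxu ((h.mem_range_iff_of_reachable (hx.reachable i)).2 hS)
  have hn5 : 5 ≤ n := by
    have := Set.ncard_le_ncard hxS
    rwa [hx.ncard_range, hcard] at this
  -- Otherwise, going around the main cycle from one vertex with mate on the 5-cycle, all `n` mates
  -- would lie on it, forcing `n = 5`.
  obtain ⟨i, hi, hi'⟩ : ∃ i, μ (u i) ∈ Set.range x ∧ μ (u (i + 1)) ∉ Set.range x := by
    by_contra! hall
    obtain ⟨j, hj⟩ := (h.mem_range _).2 hxu
    have hge (k : ℕ) : μ (u (j + k)) ∈ Set.range x := by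
      induction k with
      | zero => rw [Nat.add_zero, hj, h.invol]; exact ⟨0, rfl⟩
      | succ k ih => exact hall _ ih
    have hsub : μ '' Set.range u ⊆ Set.range x := by
      rintro _ ⟨_, ⟨k, rfl⟩, rfl⟩
      -- Adding `(n - 1) * j` undoes the offset `j` modulo `n`.
      have := hge ((n - 1) * j + k)
      obtain ⟨l, hl⟩ := Nat.exists_eq_add_of_le' h.param.three_le
      have e : u (j + ((n - 1) * j + k)) = u k := by
        rw [h.param.eq_iff]
        have : j + ((n - 1) * j + k) = k + n * j := by
          subst hl
          rw [show l + 3 - 1 = l + 2 by omega]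
          ring
        rw [this, Nat.add_mul_mod_self_left]
      rwa [e] at this
    have := Set.ncard_le_ncard hsub
    rw [Set.ncard_image_of_injective _ h.injective, h.param.ncard_range, hx.ncard_range] at this
    exact hn (by omega)
  have hshift : (Set.range fun k => u (k + i)) = Set.range u := by
    ext v
    have h1 := h.mem_range v
    have h2 := (h.shift i).mem_range v
    constructor
    · rintro ⟨k, rfl⟩
      exact ⟨_, rfl⟩
    · intro hv
      by_contra hv'
      obtain ⟨k, hk⟩ := h2.2 hv'
      exact h1.1 ⟨k + i, hk⟩ hv
  have hreach {v w : V} (hv : v ∈ Set.range x) (hw : w ∈ Set.range x) : H.Reachable v w := by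
    obtain ⟨k, rfl⟩ := hv
    obtain ⟨l, rfl⟩ := hw
    exact (hx.reachable k).symm.trans (hx.reachable l)
  refine (h.shift i).isSColorable_of_special (fun y hy hyu => ?_) fun hp => ?_
  · rw [hshift] at hyu
    rw [Nat.zero_add]
    exact hreach hi ((h5 y hy hyu) ▸ ⟨0, rfl⟩)
  · rw [Nat.zero_add, Nat.add_comm 1 i] at hp
    obtain ⟨k, hk⟩ := hi
    rw [← hk] at hp
    exact absurd (hx.mem_range_of_reachable h.two ((hx.reachable k).trans hp)) hi'

end IsMatchedCycle

/-! ### Deriving the matched cycle from the hypotheses. -/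

/-- The matching function of a perfect matching. -/
theorem exists_mate {G : SimpleGraph V} {M : G.Subgraph} (hM : M.IsPerfectMatching) :
    ∃ μ : V → V, (∀ v, M.Adj v (μ v)) ∧ ∀ v, μ (μ v) = v := by
  have h (v : V) := hM.1 (hM.2 v)
  choose μ hμ huniq using h
  exact ⟨μ, hμ, fun v => (huniq _ v (hμ v).symm).symm⟩

end PackingColoring

theorem theorem4p1 {V : Type*} [Fintype V] (G : SimpleGraph V) [DecidableRel G.Adj] (n : ℕ)
    (hconn : G.Connected) (hcubic : G.IsRegularOfDegree 3) (hcard : Fintype.card V = 2 * n)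
    (F : G.Subgraph) (hF : PackingColoring.IsTwoFactor F)
    (M : G.Subgraph) (hM : M.IsPerfectMatching)
    (C : G.Subgraph) (hCF : C ≤ F) (hC : PackingColoring.IsCycleOfLength C n)
    (hMC : ∀ u v : V, M.Adj u v → ¬ (u ∈ C.verts ∧ v ∈ C.verts))
    (hfive : ∀ D₁ D₂ : G.Subgraph, D₁ ≤ F → D₂ ≤ F →
      PackingColoring.IsCycleOfLength D₁ 5 → PackingColoring.IsCycleOfLength D₂ 5 → D₁ = D₂) :
    PackingColoring.IsSColorable G ![1, 1, 2, 2] ∧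
      PackingColoring.packingChromaticNumber (PackingColoring.subdivision G) ≤ 5 := by
  suffices h : PackingColoring.IsSColorable G ![1, 1, 2, 2] from
    ⟨h, h.packingChromaticNumber_subdivision_le⟩
  classical
  have htwo : ∀ v, (F.spanningCoe.neighborSet v).ncard = 2 := hF.2
  obtain ⟨u, hu, huC⟩ := hC.exists_isCycleParam hCF
  obtain ⟨μ, hμM, hinv⟩ := PackingColoring.exists_mate hM
  have hinj : Function.Injective μ := Function.LeftInverse.injective hinv
  have hcompl : (Set.range u)ᶜ.ncard = n := by
    have := Set.ncard_add_ncard_compl (Set.range u)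
    rw [hu.ncard_range, Nat.card_eq_fintype_card, hcard] at this
    omega
  have hout {v : V} (hv : v ∈ Set.range u) : μ v ∉ Set.range u := by
    rw [huC] at *
    exact fun hS => hMC _ _ (hμM v) ⟨hv, hS⟩
  have himage : μ '' Set.range u = (Set.range u)ᶜ := by
    refine Set.eq_of_subset_of_ncard_le ?_ ?_
    · rintro _ ⟨v, hv, rfl⟩
      exact hout hv
    · rw [hcompl, Set.ncard_image_of_injective _ hinj, hu.ncard_range]
  have hmem (v : V) : μ v ∈ Set.range u ↔ v ∉ Set.range u := by
    refine ⟨fun h hv => hout hv h, fun hv => ?_⟩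
    obtain ⟨w, hw, rfl⟩ : v ∈ μ '' Set.range u := by rw [himage]; exact hv
    rwa [hinv]
  have hstep {v w : V} (hv : v ∈ Set.range u) (hvw : F.Adj v w) : w ∈ Set.range u := by
    obtain ⟨i, rfl⟩ := hv
    obtain rfl | rfl := hu.eq_or_eq_of_adj htwo hvw
    exacts [⟨_, rfl⟩, ⟨_, rfl⟩]
  -- Edges of `F` never leave the vertex set of `C`, while matching edges always do; so the mate is
  -- a third neighbour besides the two in `F`.
  have hmate (v : V) : ¬ F.Adj v (μ v) := fun hv => by
    by_cases hS : v ∈ Set.range u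
    · exact hout hS (hstep hS hv)
    · exact hS (hstep ((hmem v).2 hS) hv.symm)
  have hadj (v w : V) (hvw : G.Adj v w) : F.spanningCoe.Adj v w ∨ w = μ v := by
    have hsub : insert (μ v) (F.neighborSet v) ⊆ G.neighborSet v := by
      rintro z (rfl | hz)
      exacts [M.adj_sub (hμM v), F.adj_sub hz]
    have hdeg : (G.neighborSet v).ncard = 3 := by
      rw [← Nat.card_coe_set_eq, Nat.card_eq_fintype_card, SimpleGraph.card_neighborSet_eq_degree]
      exact hcubic v
    have := Set.eq_of_subset_of_ncard_le hsub (by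
      rw [hdeg, Set.ncard_insert_of_notMem (show μ v ∉ F.neighborSet v from hmate v), hF.2 v])
    have hw : w ∈ insert (μ v) (F.neighborSet v) := by rw [this]; exact hvw
    exact (Set.mem_insert_iff.1 hw).symm
  have h : PackingColoring.IsMatchedCycle G F.spanningCoe μ n u := ⟨htwo, hu, hinv, hmem, hadj⟩
  have huniq {x y : ℕ → V} (hx : PackingColoring.IsCycleParam F.spanningCoe 5 x)
      (hy : PackingColoring.IsCycleParam F.spanningCoe 5 y) : Set.range y = Set.range x := by
    have hle (z : ℕ → V) : F.induce (Set.range z) ≤ F :=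
      ⟨fun v _ => hF.1 v, fun v w hvw => hvw.2.2⟩
    exact congrArg SimpleGraph.Subgraph.verts (hfive _ _ (hle y) (hle x)
      (hy.isCycleOfLength_induce htwo) (hx.isCycleOfLength_induce htwo))
  by_cases h5 : ∃ x, PackingColoring.IsCycleParam F.spanningCoe 5 x ∧ x 0 ∉ Set.range u
  · obtain ⟨x, hx, hxu⟩ := h5
    refine h.isSColorable_of_five_cycle hx hxu ?_ hcompl fun y hy _ => huniq hx hy
    -- For `n = 5` the cycle `C` would itself be the only 5-cycle and so contain `x 0`.
    rintro rfl
    exact hxu (huniq hx hu ▸ ⟨0, rfl⟩)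
  · push Not at h5
    obtain hn | hn := Nat.even_or_odd n
    · exact h.isSColorable_of_even hn h5
    · refine h.isSColorable_of_special (fun x hx hxu => absurd (h5 x hx) hxu)
        fun _ => ⟨hn, fun x hx e => hout ⟨0, rfl⟩ (e ▸ h5 x hx)⟩
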